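/- Fix a finite alphabet $A$. For languages $K,L\subseteq A^*$, a word $u\in A^*$ and a letter $a\in A$, write $u^{-1}L=\{w\in A^*\mid uw\in L\}$, $Lu^{-1}=\{w\in A^*\mid wu\in L\}$ and $KaL=\{xay\mid x\in K,\ y\in L\}$. A class (set) $\mathcal{C}$ of languages over $A$ is a \emph{quotienting lattice of regular languages} if all its members are regular, $\emptyset,A^*\in\mathcal{C}$, it is closed under union and intersection, and $u^{-1}L,\,Lu^{-1}\in\mathcal{C}$ for all $L\in\mathcal{C}$ and $u\in A^*$. The polynomial closure $\mathrm{Pol}(\mathcal{C})$ is the smallest class containing $\mathcal{C}$ such that $H\cup L$ and $HaL$ belong to it whenever $H$ and $L$ do and $a\in A$. Moreover, $\text{co-}\mathrm{Pol}(\mathcal{C})=\{L\subseteq A^*\mid A^*\setminus L\in\mathrm{Pol}(\mathcal{C})\}$. For a regular language $L$, let $\alpha_L:A^*\to M_L=A^*/{\equiv_L}$ be its syntactic morphism, where $u\equiv_L v$ iff for all $x,y\in A^*$ ($xuy\in L\Leftrightarrow xvy\in L$). The monoid $M_L$ is finite and is ordered by the syntactic order: $s\leq_L t$ iff for all $x,y\in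 M_L$, $xsy\in\alpha_L(L)$ implies $xty\in\alpha_L(L)$. Let $\omega\geq 1$ be an integer such that $s^\omega$ is idempotent for every $s\in M_L$ (the elements $s^\omega$ and $s^{\omega+1}$ do not depend on its choice). A pair $(s,t)\in M_L^2$ is a \emph{$\mathcal{C}$-pair} (for $\alpha_L$) if there is no $K\in\mathcal{C}$ with $\alpha_L^{-1}(s)\subseteq K$ and $\alpha_L^{-1}(t)\cap K=\emptyset$. \textbf{Corollary.} Let $\mathcal{C}$ be a quotienting lattice of regular languages and let $L$ be a regular language, both over $A$. Then the following three properties are equivalent: \begin{enumerate} \item $L\in\text{co-}\mathrm{Pol}(\mathcal{C})$. \item $s^{\omega}ts^{\omega}\leq_L s^{\omega+1}$ for all $\mathcal{C}$-pairs $(s,t)\in M_L^2$. \item $ete\leq_L e$ for all $\mathcal{C}$-pairs $(e,t)\in M_L^2$ with $e$ idempotent. \end{enumerate} -/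

import Mathlib

namespace PolynomialClosure

/-! ### Classes of languages -/

/-- The right quotient `L u⁻¹ = {w | w u ∈ L}` (the left quotient `u⁻¹ L` is
`Language.leftQuotient`). -/
def rightQuotient {A : Type*} (L : Language A) (u : List A) : Language A :=
  {w : List A | w ++ u ∈ L}

/-- A class of languages over `A` is a lattice when it contains `∅` and `A*` and is closed under
(binary) union and intersection. -/
structure IsLatticeClass {A : Type*} (C : Set (Language A)) : Prop where
  empty_mem : (⊥ : Language A) ∈ C
  univ_mem : (⊤ : Language A) ∈ C
  union_mem : ∀ K ∈ C, ∀ L ∈ C, K ⊔ L ∈ C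
  inter_mem : ∀ K ∈ C, ∀ L ∈ C, K ⊓ L ∈ C

/-- A class of languages is quotienting when it is closed under left and right quotients by
words. -/
structure IsQuotientingClass {A : Type*} (C : Set (Language A)) : Prop where
  leftQuotient_mem : ∀ L ∈ C, ∀ u : List A, L.leftQuotient u ∈ C
  rightQuotient_mem : ∀ L ∈ C, ∀ u : List A, rightQuotient L u ∈ C

/-- A quotienting lattice of regular languages. -/
structure IsRegularQuotientingLattice {A : Type*} (C : Set (Language A)) : Prop where
  isLattice : IsLatticeClass C
  isQuotienting : IsQuotientingClass C
  isRegular : ∀ L ∈ C, L.IsRegular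

/-- The marked concatenation `K a L`. -/
def markedConcat {A : Type*} (K : Language A) (a : A) (L : Language A) : Language A :=
  K * ({[a]} : Language A) * L

/-- Membership in the polynomial closure of `C`: the smallest class containing `C` and closed
under marked concatenation and union. -/
inductive MemPol {A : Type*} (C : Set (Language A)) : Language A → Prop
  | base (L : Language A) : L ∈ C → MemPol C L
  | marked (H : Language A) (a : A) (L : Language A) :
      MemPol C H → MemPol C L → MemPol C (markedConcat H a L)
  | union (H L : Language A) : MemPol C H → MemPol C L → MemPol C (H ⊔ L)

/-- The polynomial closure `Pol(C)`. -/
def Pol {A : Type*} (C : Set (Language A)) : Set (Language A) := {L | MemPol C L}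

/-- The class `co-Pol(C)` of all complements of languages in `Pol(C)`. -/
def coPol {A : Type*} (C : Set (Language A)) : Set (Language A) := {L | Lᶜ ∈ Pol C}

/-! ### Separation and `C`-pairs -/

/-- `K` separates `L₁` from `L₂` when `L₁ ⊆ K` and `L₂ ∩ K = ∅`. -/
def Separates {A : Type*} (K L₁ L₂ : Language A) : Prop := L₁ ≤ K ∧ L₂ ⊓ K = ⊥

/-- `L₁` is `C`-separable from `L₂` when some language of `C` separates `L₁` from `L₂`. -/
def Separable {A : Type*} (C : Set (Language A)) (L₁ L₂ : Language A) : Prop :=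
  ∃ K ∈ C, Separates K L₁ L₂

/-- The language `α⁻¹(s)`. -/
def fiber {A M : Type*} [Monoid M] (α : FreeMonoid A →* M) (s : M) : Language A :=
  {w : List A | α (FreeMonoid.ofList w) = s}

/-- `(s, t)` is a `C`-pair for the morphism `α : A* → M` when `α⁻¹(s)` is not `C`-separable from
`α⁻¹(t)`. -/
def IsCPair {A M : Type*} [Monoid M] (C : Set (Language A)) (α : FreeMonoid A →* M)
    (s t : M) : Prop :=
  ¬ Separable C (fiber α s) (fiber α t)

/-! ### The syntactic ordered monoid -/

/-- The syntactic congruence of `L`. -/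
def syntacticCon {A : Type*} (L : Language A) : Con (FreeMonoid A) where
  r u v := ∀ x y : FreeMonoid A, (x * u * y).toList ∈ L ↔ (x * v * y).toList ∈ L
  iseqv := ⟨fun _ _ _ => Iff.rfl, fun h x y => (h x y).symm,
    fun h₁ h₂ x y => (h₁ x y).trans (h₂ x y)⟩
  mul' := by
    intro u u' v v' h₁ h₂ x y
    have e₁ := h₁ x (v * y)
    have e₂ := h₂ (x * u') y
    simp only [mul_assoc] at e₁ e₂ ⊢
    exact e₁.trans e₂

/-- The syntactic monoid `M_L = A* / ≡_L`. -/
def SyntacticMonoid {A : Type*} (L : Language A) : Type _ := (syntacticCon L).Quotient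

instance instMonoidSyntacticMonoid {A : Type*} (L : Language A) : Monoid (SyntacticMonoid L) :=
  inferInstanceAs (Monoid (syntacticCon L).Quotient)

/-- The syntactic morphism `α_L : A* → M_L`. -/
def syntacticHom {A : Type*} (L : Language A) : FreeMonoid A →* SyntacticMonoid L :=
  (syntacticCon L).mk'

theorem syntacticHom_surjective {A : Type*} (L : Language A) :
    Function.Surjective (syntacticHom L) := Con.mk'_surjective

/-- The image `α_L(L)` of `L` in its syntactic monoid. -/
def acceptingSet {A : Type*} (L : Language A) : Set (SyntacticMonoid L) :=
  syntacticHom L '' {w | w.toList ∈ L}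

theorem syntacticHom_eq_iff {A : Type*} (L : Language A) (u v : FreeMonoid A) :
    syntacticHom L u = syntacticHom L v ↔
      ∀ x y : FreeMonoid A, (x * u * y).toList ∈ L ↔ (x * v * y).toList ∈ L :=
  (syntacticCon L).eq

theorem syntacticHom_mem_acceptingSet {A : Type*} (L : Language A) (w : FreeMonoid A) :
    syntacticHom L w ∈ acceptingSet L ↔ w.toList ∈ L := by
  constructor
  · rintro ⟨v, hv, hvw⟩
    have h := (syntacticHom_eq_iff L v w).1 hvw 1 1
    simp only [one_mul, mul_one] at h
    exact h.1 hv
  · exact fun h => ⟨w, h, rfl⟩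

/-- The syntactic order: `s ≤_L t` when `x s y ∈ α_L(L)` implies `x t y ∈ α_L(L)` for all
`x, y ∈ M_L`. -/
instance instPartialOrderSyntacticMonoid {A : Type*} (L : Language A) :
    PartialOrder (SyntacticMonoid L) where
  le s t := ∀ x y : SyntacticMonoid L, x * s * y ∈ acceptingSet L → x * t * y ∈ acceptingSet L
  le_refl _ _ _ h := h
  le_trans _ _ _ h₁ h₂ x y h := h₂ x y (h₁ x y h)
  le_antisymm s t h₁ h₂ := by
    obtain ⟨u, rfl⟩ := syntacticHom_surjective L s
    obtain ⟨v, rfl⟩ := syntacticHom_surjective L t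
    refine (syntacticHom_eq_iff L u v).2 fun x y => ?_
    rw [← syntacticHom_mem_acceptingSet, ← syntacticHom_mem_acceptingSet]
    simp only [map_mul]
    exact ⟨h₁ _ _, h₂ _ _⟩

/-- The syntactic monoid of a regular language is finite. -/
theorem finite_syntacticMonoid {A : Type*} {L : Language A} (hL : L.IsRegular) :
    Finite (SyntacticMonoid L) := by
  obtain ⟨σ, _, D, rfl⟩ := hL
  have key : ∀ u v : FreeMonoid A,
      (fun q => D.evalFrom q u.toList) = (fun q => D.evalFrom q v.toList) →
      syntacticHom D.accepts u = syntacticHom D.accepts v := by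
    intro u v h
    refine (syntacticHom_eq_iff _ u v).2 fun x y => ?_
    have hx := congrFun h (D.evalFrom D.start x.toList)
    simp only [FreeMonoid.toList_mul, DFA.mem_accepts, DFA.eval, DFA.evalFrom_of_append, hx]
  refine Finite.of_injective
    (fun s : SyntacticMonoid D.accepts => fun q : σ =>
      D.evalFrom q (Function.surjInv (syntacticHom_surjective D.accepts) s).toList) ?_
  intro s t h
  have hst := key _ _ h
  have hs := Function.surjInv_eq (syntacticHom_surjective D.accepts) s
  have ht := Function.surjInv_eq (syntacticHom_surjective D.accepts) t
  exact hs.symm.trans (hst.trans ht)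

/-! ### Idempotent powers -/

/-- The number `ω(M)`: the least positive integer `n` such that `s ^ n` is idempotent for
every `s ∈ M`. It exists whenever `M` is finite, see `omegaPow_spec`. -/
noncomputable def omegaPow (M : Type*) [Monoid M] : ℕ :=
  sInf {n : ℕ | 0 < n ∧ ∀ s : M, IsIdempotentElem (s ^ n)}

theorem omegaPow_spec (M : Type*) [Monoid M] [Finite M] :
    0 < omegaPow M ∧ ∀ s : M, IsIdempotentElem (s ^ omegaPow M) := by
  have key : ∀ s : M, ∃ n : ℕ, 0 < n ∧ IsIdempotentElem (s ^ n) := by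
    intro s
    obtain ⟨i, j, hij, h⟩ : ∃ i j : ℕ, i < j ∧ s ^ i = s ^ j := by
      obtain ⟨a, b, hne, hab⟩ := Finite.exists_ne_map_eq_of_infinite (fun n : ℕ => s ^ n)
      rcases lt_or_gt_of_ne hne with hlt | hlt
      · exact ⟨a, b, hlt, hab⟩
      · exact ⟨b, a, hlt, hab.symm⟩
    obtain ⟨p, rfl⟩ : ∃ p, j = i + p := ⟨j - i, by omega⟩
    have hp : 0 < p := by omega
    have per : ∀ m k : ℕ, i ≤ m → s ^ (m + p * k) = s ^ m := by
      intro m k hm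
      induction k with
      | zero => simp
      | succ k ih =>
        obtain ⟨d, rfl⟩ := Nat.exists_eq_add_of_le hm
        calc s ^ (i + d + p * (k + 1)) = s ^ (i + p) * s ^ (d + p * k) := by
              rw [← pow_add]; congr 1; ring
          _ = s ^ (i + d + p * k) := by rw [← h, ← pow_add]; congr 1; ring
          _ = s ^ (i + d) := ih
    refine ⟨p * (i + 1), by positivity, ?_⟩
    have := per (p * (i + 1)) (i + 1) (by nlinarith)
    rw [IsIdempotentElem, ← pow_add]
    exact this
  choose f hf hid using key
  have : Fintype M := Fintype.ofFinite M
  have hne : {n : ℕ | 0 < n ∧ ∀ s : M, IsIdempotentElem (s ^ n)}.Nonempty := by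
    refine ⟨∏ s, f s, Finset.prod_pos fun s _ => hf s, fun s => ?_⟩
    obtain ⟨k, hk⟩ := Finset.dvd_prod_of_mem f (Finset.mem_univ s)
    rw [hk, pow_mul]
    exact (hid s).pow k
  exact Nat.sInf_mem hne

end PolynomialClosure

/-!
Condition 2 is necessary because a language of `Pol(C)` that contains `x u ^ (n m + 1) y` for a
large `m` also contains some `x u ^ (n i) v u ^ (n j) y`, as soon as finitely many languages of `C`
fail to separate `u` from `v`. By compactness such words `u` and `v` exist above every `C`-pair.

Condition 3 is sufficient because it places each `α⁻¹(s)` inside a language of `Pol(C)` whose words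
have images at most `s`. Such covers pass to unions and products, and also to iterations `X*` when
`α` maps `X` to one idempotent `e`: a long product lies in `X α⁻¹(e) X`, and on replacing `α⁻¹(e)`
by the language of `C` that separates `e` from all `t` for which `(e, t)` is not a `C`-pair, the
images stay below `e` since `e t e ≤ e`. Simon's factorization forest theorem would reduce all words
to these operations; instead, states of the right Cayley graph are eliminated, by induction on the
submonoid in which the images lie.
-/

namespace PolynomialClosure

open scoped Pointwise

section Factorization

variable {F M : Type*} [Monoid F] [Monoid M]

theorem closure_union_subset_mul (X Y : Set F) :
    (Submonoid.closure (X ∪ Y) : Set F) ⊆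
      Submonoid.closure Y * Submonoid.closure (X * (Submonoid.closure Y : Set F)) := by
  intro w hw
  induction hw using Submonoid.closure_induction_left with
  | one => exact ⟨1, one_mem _, 1, one_mem _, one_mul 1⟩
  | mul_left x hx _ _ ih =>
    obtain ⟨u, hu, b, hb, rfl⟩ := ih
    rcases hx with hx | hx
    · have hxu : x * u ∈ X * (Submonoid.closure Y : Set F) := Set.mul_mem_mul hx hu
      exact ⟨1, one_mem _, x * u * b, mul_mem (Submonoid.subset_closure hxu) hb, by
        simp [mul_assoc]⟩
    · exact ⟨x * u, mul_mem (Submonoid.subset_closure hx) hu, b, hb, mul_assoc _ _ _⟩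

theorem closure_subset_of_map_eq_idempotent {α : F →* M} {e : M} (he : IsIdempotentElem e)
    {X : Set F} (hX : ∀ x ∈ X, α x = e) :
    (Submonoid.closure X : Set F) ⊆ {1} ∪ X ∪ X * X ∪ X * (α ⁻¹' {e}) * X := by
  intro w hw
  induction hw using Submonoid.closure_induction_right with
  | one => exact .inl (.inl (.inl rfl))
  | mul_right w _ y hy ih =>
    rcases ih with ((rfl | hw) | ⟨x, hx, x', hx', rfl⟩) | ⟨_, ⟨x, hx, v, hv, rfl⟩, x', hx', rfl⟩
    · exact .inl (.inl (.inr (by rwa [one_mul])))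
    · exact .inl (.inr (Set.mul_mem_mul hw hy))
    · exact .inr (Set.mul_mem_mul (Set.mul_mem_mul hx (hX x' hx')) hy)
    · have hvx' : α (v * x') = e := by rw [map_mul, hX x' hx', show α v = e from hv, he.eq]
      exact .inr ⟨_, ⟨x, hx, v * x', hvx', rfl⟩, y, hy, by simp only [mul_assoc]⟩

/-- The right stabilizer `{m | q m = q}` of `q`, which contains the image of every loop at the
state `q` of the right Cayley graph. -/
def rightStabilizer (q : M) : Submonoid M :=
  (MulAction.stabilizerSubmonoid Mᵐᵒᵖ q).unop

theorem mem_rightStabilizer {q m : M} : m ∈ rightStabilizer q ↔ q * m = q := Iff.rfl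

/-- `Run α X Q p w` says that `w` is a product of elements of `X` such that the state `p`, moved
by right multiplication with the images under `α`, lies in `Q` after each factor. The starting
state `p` itself need not lie in `Q`. -/
inductive Run (α : F →* M) (X : Set F) (Q : Set M) (p : M) : F → Prop
  | one : Run α X Q p 1
  | mul (w x : F) : Run α X Q p w → x ∈ X → p * α (w * x) ∈ Q → Run α X Q p (w * x)

/-- Runs from `p` through `Q` followed by one more factor, which leads to a state in `R`. -/
def exitRuns (α : F →* M) (X : Set F) (Q R : Set M) (p : M) : Set F :=
  {y ∈ {w | Run α X Q p w} * X | p * α y ∈ R}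

section Runs

variable {α : F →* M} {X : Set F} {Q R : Set M} {p : M}

theorem Run.mem_closure {w : F} (hw : Run α X Q p w) : w ∈ Submonoid.closure X := by
  induction hw with
  | one => exact one_mem _
  | mul w x _ hx _ ih => exact mul_mem ih (Submonoid.subset_closure hx)

theorem exitRuns_subset_closure : exitRuns α X Q R p ⊆ Submonoid.closure X := by
  rintro _ ⟨⟨w, hw, x, hx, rfl⟩, -⟩
  exact mul_mem (Run.mem_closure hw) (Submonoid.subset_closure hx)

theorem mul_map_of_mem_closure_exitRuns {q : M} {l : F}
    (hl : l ∈ Submonoid.closure (exitRuns α X Q {q} q)) : q * α l = q := by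
  have hle : Submonoid.closure (exitRuns α X Q {q} q) ≤ (rightStabilizer q).comap α :=
    Submonoid.closure_le.2 fun y hy => mem_rightStabilizer.2 hy.2
  exact hle hl

/-- One step of state elimination: cut a run through `insert q Q` at its visits to `q`. -/
theorem setOf_run_insert_subset (q : M) :
    {w | Run α X (insert q Q) p w} ⊆ {w | Run α X Q p w} ∪
      exitRuns α X Q {q} p * Submonoid.closure (exitRuns α X Q {q} q) * {w | Run α X Q q w} := by
  intro w hw
  induction hw with
  | one => exact .inl .one
  | mul w x _ hx h ih =>
    rcases ih with hw | ⟨_, ⟨y, hy, l, hl, rfl⟩, k, hk, rfl⟩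
    · rcases h with hq | hQ
      · have hwx : w * x ∈ exitRuns α X Q {q} p := ⟨Set.mul_mem_mul hw hx, hq⟩
        exact .inr ⟨_, ⟨_, hwx, 1, one_mem _, mul_one _⟩, 1, .one, mul_one _⟩
      · exact .inl (.mul w x hw hx hQ)
    · have hstate : p * α (y * l * k * x) = q * α (k * x) := by
        rw [mul_assoc (y * l), map_mul, map_mul, ← mul_assoc, ← mul_assoc,
          show p * α y = q from hy.2, mul_map_of_mem_closure_exitRuns hl]
      rw [hstate] at h
      rcases h with hq | hQ
      · have hkx : k * x ∈ exitRuns α X Q {q} q := ⟨Set.mul_mem_mul hk hx, hq⟩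
        exact .inr ⟨y * (l * (k * x)), ⟨y, hy, l * (k * x),
          mul_mem hl (Submonoid.subset_closure hkx), rfl⟩, 1, .one, by simp [mul_assoc]⟩
      · exact .inr ⟨y * l, Set.mul_mem_mul hy hl, k * x, .mul k x hk hx hQ, by simp [mul_assoc]⟩

theorem closure_subset_closure_exitRuns_mul (h : ∀ w ∈ Submonoid.closure X, α w ∈ Q ∪ R) :
    (Submonoid.closure X : Set F) ⊆
      Submonoid.closure (exitRuns α X Q R 1) * {w | Run α X Q 1 w} := by
  intro w hw
  induction hw using Submonoid.closure_induction_right with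
  | one => exact ⟨1, one_mem _, 1, .one, one_mul 1⟩
  | mul_right w _ x hx ih =>
    obtain ⟨y, hy, k, hk, rfl⟩ := ih
    have hkx := h _ (mul_mem (Run.mem_closure hk) (Submonoid.subset_closure hx))
    rw [← one_mul (α _)] at hkx
    rcases hkx with hQ | hR
    · exact ⟨y, hy, k * x, .mul k x hk hx hQ, (mul_assoc _ _ _).symm⟩
    · have hexit : k * x ∈ exitRuns α X Q R 1 := ⟨Set.mul_mem_mul hk hx, hR⟩
      exact ⟨y * (k * x), mul_mem hy (Submonoid.subset_closure hexit), 1, .one, by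
        simp [mul_assoc]⟩

end Runs

/-- A family of subsets of `F` that is closed under the operations of a factorization forest for
`α`: subsets, binary unions, products, and iteration of a set whose image is a single idempotent.
When `M` is finite, it is closed under all iterations. -/
structure IsFactorizationFamily (α : F →* M) (P : Set F → Prop) : Prop where
  mono : ∀ {X Y : Set F}, X ⊆ Y → P Y → P X
  one : P {1}
  union : ∀ {X Y : Set F}, P X → P Y → P (X ∪ Y)
  mul : ∀ {X Y : Set F}, P X → P Y → P (X * Y)
  closure_of_idempotent : ∀ {X : Set F} {e : M}, IsIdempotentElem e → (∀ x ∈ X, α x = e) → P X →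
    P (Submonoid.closure X : Set F)

namespace IsFactorizationFamily

variable {α : F →* M} {P : Set F → Prop}

theorem closure_of_leftZeros (hP : IsFactorizationFamily α P) {Z : Set M} (hZ : Z.Finite)
    (hz : ∀ z ∈ Z, ∀ t ∈ Z, z * t = z) {X : Set F} (hX : P X) (hXZ : ∀ x ∈ X, α x ∈ Z) :
    P (Submonoid.closure X : Set F) := by
  induction Z, hZ using Set.Finite.induction_on generalizing X with
  | empty =>
    obtain rfl : X = ∅ := Set.eq_empty_of_forall_notMem hXZ
    simpa using hP.one
  | @insert z Z _ _ ih =>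
    let U : Submonoid F := Submonoid.closure {x ∈ X | α x ∈ Z}
    have hU : P (U : Set F) :=
      ih (fun a ha b hb => hz a (.inr ha) b (.inr hb)) (hP.mono (Set.sep_subset _ _) hX)
        fun x hx => hx.2
    have hzU : U ≤ (rightStabilizer z).comap α :=
      Submonoid.closure_le.2 fun x hx => hz z (.inl rfl) _ (.inr hx.2)
    have hzXU : P (Submonoid.closure ({x ∈ X | α x = z} * (U : Set F)) : Set F) := by
      refine hP.closure_of_idempotent (hz z (.inl rfl) z (.inl rfl)) ?_
        (hP.mul (hP.mono (Set.sep_subset _ _) hX) hU)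
      rintro _ ⟨x, hx, u, hu, rfl⟩
      rw [map_mul, hx.2, mem_rightStabilizer.1 (hzU hu)]
    have hsplit : X ⊆ {x ∈ X | α x = z} ∪ {x ∈ X | α x ∈ Z} := fun x hx =>
      (hXZ x hx).imp (⟨hx, ·⟩) (⟨hx, ·⟩)
    refine hP.mono (fun w hw => ?_) (hP.mul hU hzXU)
    exact closure_union_subset_mul _ _ (Submonoid.closure_mono hsplit hw)

theorem exitRuns (hP : IsFactorizationFamily α P) {X : Set F} (hX : P X) {Q : Set M} {p : M}
    (hrun : P {w | Run α X Q p w}) (R : Set M) : P (exitRuns α X Q R p) :=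
  hP.mono (Set.sep_subset _ _) (hP.mul hrun hX)

theorem setOf_run (hP : IsFactorizationFamily α P) {X : Set F} (hX : P X) {Q : Set M}
    (hQ : Q.Finite)
    (hloop : ∀ q ∈ Q, ∀ Y ⊆ (Submonoid.closure X : Set F), P Y →
      (∀ y ∈ Y, α y ∈ rightStabilizer q) → P (Submonoid.closure Y : Set F)) (p : M) :
    P {w | Run α X Q p w} := by
  induction Q, hQ using Set.Finite.induction_on generalizing p with
  | empty =>
    refine hP.mono ?_ hP.one
    rintro _ (_ | ⟨_, _, _, _, h⟩)
    exacts [rfl, h.elim]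
  | @insert q Q _ _ ih =>
    replace ih := ih fun r hr => hloop r (.inr hr)
    have hloops : P (Submonoid.closure (PolynomialClosure.exitRuns α X Q {q} q) : Set F) :=
      hloop q (.inl rfl) _ exitRuns_subset_closure (hP.exitRuns hX (ih q) _) fun _ hy => hy.2
    exact hP.mono (setOf_run_insert_subset q)
      (hP.union (ih p) (hP.mul (hP.mul (hP.exitRuns hX (ih p) {q}) hloops) (ih q)))

/-- Track the image of the product read so far. Its loops at a state that is not a left zero of
`N` have images in a proper submonoid of `N`; the remaining states form a band of left zeros. -/
theorem closure_of_map_mem [Finite M] (hP : IsFactorizationFamily α P) (N : Submonoid M)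
    {X : Set F} (hX : P X) (hXN : ∀ x ∈ X, α x ∈ N) : P (Submonoid.closure X : Set F) := by
  induction N using WellFoundedLT.induction generalizing X with
  | ind N ih =>
    have hmap : Submonoid.closure X ≤ N.comap α := Submonoid.closure_le.2 hXN
    let Z : Set M := {z ∈ N | N ≤ rightStabilizer z}
    have hrun : P {w | Run α X (N \ Z) 1 w} := by
      refine hP.setOf_run hX (Set.toFinite _) (fun q hq Y hYX hY hYq => ?_) 1
      have hlt : N ⊓ rightStabilizer q < N := inf_lt_left.2 fun hle => hq.2 ⟨hq.1, hle⟩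
      exact ih _ hlt hY fun y hy => ⟨hmap (hYX hy), hYq y hy⟩
    have hexit : P (Submonoid.closure (PolynomialClosure.exitRuns α X (N \ Z) Z 1) : Set F) := by
      refine hP.closure_of_leftZeros (Set.toFinite Z) (fun z hz t ht => hz.2 ht.1)
        (hP.exitRuns hX hrun Z) fun y hy => ?_
      simpa only [one_mul] using hy.2
    refine hP.mono (closure_subset_closure_exitRuns_mul fun w hw => ?_) (hP.mul hexit hrun)
    rw [Set.sdiff_union_self]
    exact .inl (hmap hw)

theorem closure [Finite M] (hP : IsFactorizationFamily α P) {X : Set F} (hX : P X) :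
    P (Submonoid.closure X : Set F) :=
  hP.closure_of_map_mem ⊤ hX fun _ _ => Submonoid.mem_top _

end IsFactorizationFamily

end Factorization

section Languages

variable {A : Type*} {C : Set (Language A)} {K L : Language A}

theorem mem_markedConcat {a : A} {w : List A} :
    w ∈ markedConcat K a L ↔ ∃ p ∈ K, ∃ q ∈ L, p ++ a :: q = w := by
  rw [markedConcat, mul_assoc]
  constructor
  · rintro ⟨p, hp, _, ⟨_, rfl, q, hq, rfl⟩, rfl⟩
    exact ⟨p, hp, q, hq, rfl⟩
  · rintro ⟨p, hp, q, hq, rfl⟩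
    exact ⟨p, hp, a :: q, ⟨[a], rfl, q, hq, rfl⟩, rfl⟩

theorem append_mem_markedConcat {a : A} {w₁ w₂ : List A} :
    w₁ ++ w₂ ∈ markedConcat K a L ↔
      w₂ ∈ markedConcat (K.leftQuotient w₁) a L ∨ w₁ ∈ markedConcat K a (rightQuotient L w₂) := by
  simp only [mem_markedConcat]
  constructor
  · rintro ⟨p, hp, q, hq, h⟩
    rcases List.append_eq_append_iff.1 h.symm with ⟨c, rfl, hc⟩ | ⟨_ | ⟨b, c⟩, hc, h'⟩
    · exact .inl ⟨c, hp, q, hq, hc.symm⟩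
    · obtain rfl : w₁ = p := by simpa using hc
      exact .inl ⟨[], by simpa using hp, q, hq, h'⟩
    · obtain ⟨rfl, rfl⟩ := List.cons.inj h'
      exact .inr ⟨p, hp, c, hq, hc.symm⟩
  · rintro (⟨p, hp, q, hq, rfl⟩ | ⟨p, hp, q, hq, rfl⟩)
    · exact ⟨w₁ ++ p, hp, q, hq, List.append_assoc _ _ _⟩
    · exact ⟨p, hp, q ++ w₂, hq, by simp⟩

theorem mem_rightQuotient_toList {w : List A} {u : FreeMonoid A} :
    w ∈ rightQuotient L u.toList ↔ (FreeMonoid.ofList w * u).toList ∈ L := Iff.rfl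

theorem mul_eq_iSup_markedConcat_sup (K L : Language A) :
    K * L = (⨆ a, markedConcat K a (L.leftQuotient [a])) ⊔ ⨆ _ : [] ∈ L, K := by
  ext w
  change _ ↔ w ∈ (⨆ a, _ : Language A) ∨ w ∈ (⨆ _, _ : Language A)
  simp only [Language.mem_iSup, mem_markedConcat, exists_prop]
  constructor
  · rintro ⟨x, hx, _ | ⟨a, y⟩, hy, rfl⟩
    · exact .inr ⟨hy, show x ++ [] ∈ K by rwa [List.append_nil]⟩
    · exact .inl ⟨a, x, hx, y, hy, rfl⟩
  · rintro (⟨a, x, hx, y, hy, rfl⟩ | ⟨hnil, hw⟩)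
    · exact ⟨x, hx, a :: y, hy, rfl⟩
    · exact ⟨w, hw, [], hnil, List.append_nil w⟩

theorem MemPol.iSup {ι : Sort*} [Finite ι] (hC : ⊥ ∈ C) {f : ι → Language A}
    (hf : ∀ i, MemPol C (f i)) : MemPol C (⨆ i, f i) :=
  SupClosed.iSup_mem (s := {L | MemPol C L}) (fun _ hK _ hL => .union _ _ hK hL) (.base _ hC) hf

theorem MemPol.mul [Finite A] (hC : ⊥ ∈ C) (hq : IsQuotientingClass C) (hK : MemPol C K)
    (hL : MemPol C L) : MemPol C (K * L) := by
  induction hL with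
  | base L hL =>
    rw [mul_eq_iSup_markedConcat_sup]
    exact .union _ _
      (.iSup hC fun a => .marked K a _ hK (.base _ (hq.leftQuotient_mem L hL [a])))
      (.iSup hC fun _ => hK)
  | union H L _ _ ihH ihL =>
    rw [show K * (H ⊔ L) = K * H ⊔ K * L from mul_add K H L]
    exact .union _ _ ihH ihL
  | marked H a L _ hL ihH _ =>
    rw [show K * markedConcat H a L = markedConcat (K * H) a L by
      simp only [markedConcat, mul_assoc]]
    exact .marked _ a _ ihH hL

theorem IsLatticeClass.iSup_mem {ι : Sort*} [Finite ι] (hC : IsLatticeClass C)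
    {f : ι → Language A} (hf : ∀ i, f i ∈ C) : ⨆ i, f i ∈ C :=
  SupClosed.iSup_mem (fun _ hK _ hL => hC.union_mem _ hK _ hL) hC.empty_mem hf

theorem IsLatticeClass.iInf_mem {ι : Sort*} [Finite ι] (hC : IsLatticeClass C)
    {f : ι → Language A} (hf : ∀ i, f i ∈ C) : ⨅ i, f i ∈ C :=
  InfClosed.iInf_mem (fun _ hK _ hL => hC.inter_mem _ hK _ hL) hC.univ_mem hf

theorem mem_iInf {ι : Sort*} {f : ι → Language A} {w : List A} :
    w ∈ ⨅ i, f i ↔ ∀ i, w ∈ f i :=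
  Set.mem_iInter

end Languages

section Recognition

variable {A M : Type*} [Monoid M] {C : Set (Language A)} {α : FreeMonoid A →* M} {L : Language A}

/-- The language `α⁻¹(U)` recognized by the morphism `α` and the set `U`. -/
def preimage (α : FreeMonoid A →* M) (U : Set M) : Language A :=
  {w : List A | α (FreeMonoid.ofList w) ∈ U}

theorem toList_mem_preimage {U : Set M} {w : FreeMonoid A} :
    w.toList ∈ preimage α U ↔ α w ∈ U := Iff.rfl

theorem preimage_acceptingSet_compl (L : Language A) :
    preimage (syntacticHom L) (acceptingSet L)ᶜ = Lᶜ := by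
  ext w
  exact (syntacticHom_mem_acceptingSet L (.ofList w)).not

theorem IsCPair.exists_words (hC : IsLatticeClass C) {s t : M} (h : IsCPair C α s t)
    {S : Set (Language A)} (hSC : S ⊆ C) (hS : S.Finite) :
    ∃ u v : FreeMonoid A, α u = s ∧ α v = t ∧ ∀ H ∈ S, u.toList ∈ H → v.toList ∈ H := by
  by_contra! hcon
  have := hS.to_subtype
  let K : Language A := ⨆ (T : Set S) (_ : fiber α t ⊓ ⨅ H : T, (H : Language A) = ⊥),
    ⨅ H : T, (H : Language A)
  have hKC : K ∈ C :=
    hC.iSup_mem fun T => hC.iSup_mem fun _ => hC.iInf_mem fun H => hSC H.1.2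
  refine h ⟨K, hKC, fun u hu => ?_, ?_⟩
  · let T : Set S := {H | u ∈ H.1}
    refine Language.mem_iSup.2 ⟨T, Language.mem_iSup.2 ⟨?_, mem_iInf.2 fun H => H.2⟩⟩
    refine le_bot_iff.1 fun v hv => ?_
    obtain ⟨H, hHS, huH, hvH⟩ := hcon (.ofList u) (.ofList v) hu hv.1
    exact hvH (mem_iInf.1 hv.2 ⟨⟨H, hHS⟩, huH⟩)
  · simp only [K, inf_iSup_eq, iSup_eq_bot, imp_self, implies_true]

theorem exists_mem_forall_isCPair [Finite M] (hC : IsLatticeClass C) (α : FreeMonoid A →* M)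
    (s : M) : ∃ K ∈ C, fiber α s ≤ K ∧ ∀ w : FreeMonoid A, w.toList ∈ K → IsCPair C α s (α w) := by
  choose f hfC hf using fun (t : M) (ht : ¬ IsCPair C α s t) => not_not.1 ht
  refine ⟨⨅ t, ⨅ ht, f t ht, hC.iInf_mem fun t => hC.iInf_mem fun ht => hfC t ht,
    le_iInf₂ fun t ht => (hf t ht).1, fun w hw => ?_⟩
  by_contra hpair
  have hmem : w.toList ∈ fiber α (α w) ⊓ f (α w) hpair :=
    ⟨rfl, mem_iInf.1 (mem_iInf.1 hw (α w)) hpair⟩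
  rw [(hf _ hpair).2] at hmem
  exact hmem

end Recognition

section Insertion

variable {A : Type*} {C : Set (Language A)} {K L : Language A} {n : ℕ}

theorem finite_range_rightQuotient_leftQuotient (hL : L.IsRegular) :
    (Set.range fun p : List A × List A => rightQuotient (L.leftQuotient p.1) p.2).Finite := by
  have := finite_syntacticMonoid hL
  refine (Set.finite_range fun p : SyntacticMonoid L × SyntacticMonoid L =>
    preimage (syntacticHom L) {s | p.1 * s * p.2 ∈ acceptingSet L}).subset ?_
  rintro _ ⟨⟨x, y⟩, rfl⟩
  refine ⟨(syntacticHom L (.ofList x), syntacticHom L (.ofList y)), ?_⟩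
  ext w
  change _ ∈ acceptingSet L ↔ x ++ (w ++ y) ∈ L
  rw [← map_mul, ← map_mul, syntacticHom_mem_acceptingSet, ← List.append_assoc]
  rfl

/-- The insertion property of languages in `Pol(C)`: when no member of a suitable finite part of
`C` contains `u` but not `v`, every long enough power `u ^ (n * m + 1)` occurring in a word of `K`
can be traded for some `u ^ (n * i) * v * u ^ (n * j)`. -/
def AdmitsInsertion (C : Set (Language A)) (n : ℕ) (K : Language A) : Prop :=
  ∃ S ⊆ C, S.Finite ∧ ∃ k, ∀ m ≥ k, ∀ x u v y : FreeMonoid A,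
    (∀ H ∈ S, u.toList ∈ H → v.toList ∈ H) → (x * u ^ (n * m + 1) * y).toList ∈ K →
      ∃ i > 0, ∃ j > 0, (x * u ^ (n * i) * v * u ^ (n * j) * y).toList ∈ K

theorem admitsInsertion_of_mem (hC : IsQuotientingClass C) (hK : K ∈ C) (hreg : K.IsRegular)
    (n : ℕ) : AdmitsInsertion C n K := by
  refine ⟨_, ?_, finite_range_rightQuotient_leftQuotient hreg, 2, fun m hm x u v y huv h => ?_⟩
  · rintro _ ⟨p, rfl⟩
    exact hC.rightQuotient_mem _ (hC.leftQuotient_mem _ hK _) _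
  obtain ⟨j, rfl⟩ : ∃ j, m = 1 + (j + 1) := ⟨m - 2, by omega⟩
  refine ⟨1, one_pos, j + 1, j.succ_pos, ?_⟩
  have hquot (w : FreeMonoid A) : w.toList ∈ rightQuotient
      (K.leftQuotient (x * u ^ (n * 1)).toList) (u ^ (n * (j + 1)) * y).toList ↔
        (x * u ^ (n * 1) * w * u ^ (n * (j + 1)) * y).toList ∈ K := by
    rw [mul_assoc _ (u ^ (n * (j + 1))), mul_assoc _ w]
    rfl
  have hpow : u ^ (n * (1 + (j + 1)) + 1) = u ^ (n * 1) * u * u ^ (n * (j + 1)) := by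
    rw [← pow_succ, ← pow_add]
    ring_nf
  rw [hpow] at h
  refine (hquot v).1 (huv _ ⟨(_, _), rfl⟩ ((hquot u).2 ?_))
  simpa only [mul_assoc] using h

theorem AdmitsInsertion.sup (hK : AdmitsInsertion C n K) (hL : AdmitsInsertion C n L) :
    AdmitsInsertion C n (K ⊔ L) := by
  obtain ⟨S, hSC, hS, k, hk⟩ := hK
  obtain ⟨T, hTC, hT, l, hl⟩ := hL
  refine ⟨S ∪ T, Set.union_subset hSC hTC, hS.union hT, max k l, fun m hm x u v y huv h => ?_⟩
  rcases h with h | h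
  · obtain ⟨i, hi, j, hj, h⟩ := hk m (le_of_max_le_left hm) x u v y (fun H hH => huv H (.inl hH)) h
    exact ⟨i, hi, j, hj, .inl h⟩
  · obtain ⟨i, hi, j, hj, h⟩ := hl m (le_of_max_le_right hm) x u v y (fun H hH => huv H (.inr hH)) h
    exact ⟨i, hi, j, hj, .inr h⟩

theorem AdmitsInsertion.markedConcat (hn : 0 < n) (hK : AdmitsInsertion C n K)
    (hL : AdmitsInsertion C n L) (a : A) : AdmitsInsertion C n (markedConcat K a L) := by
  obtain ⟨S, hSC, hS, k, hk⟩ := hK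
  obtain ⟨T, hTC, hT, l, hl⟩ := hL
  obtain ⟨r, rfl⟩ := Nat.exists_eq_add_one.2 hn
  refine ⟨S ∪ T, Set.union_subset hSC hTC, hS.union hT, k + (l + 1), fun m hm x u v y huv h => ?_⟩
  obtain ⟨m, rfl⟩ := Nat.exists_eq_add_of_le hm
  -- Cut the power in two: the part that avoids the marked letter is still long enough.
  have hcut : u ^ ((r + 1) * (k + (l + 1) + m) + 1) =
      u ^ ((r + 1) * k + 1) * u ^ ((r + 1) * (l + m + 1)) := by
    rw [← pow_add]
    ring_nf
  rw [hcut, ← mul_assoc x, mul_assoc _ _ y, FreeMonoid.toList_mul, append_mem_markedConcat,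
    mem_markedConcat, mem_markedConcat] at h
  rcases h with ⟨c, hc, d, hd, hcd⟩ | ⟨c, hc, d, hd, hcd⟩
  · obtain ⟨i, hi, j, hj, h⟩ :=
      hk k le_rfl x u v (FreeMonoid.ofList c) (fun H hH => huv H (.inl hH)) hc
    refine ⟨i, hi, j + (l + m + 1), by omega, ?_⟩
    rw [mul_add, pow_add, ← mul_assoc, mul_assoc _ _ y, FreeMonoid.toList_mul,
      append_mem_markedConcat]
    exact .inl (mem_markedConcat.2 ⟨c, h, d, hd, hcd⟩)
  · have hshift : u ^ ((r + 1) * (l + m + 1)) = u ^ r * u ^ ((r + 1) * (l + m) + 1) := by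
      rw [← pow_add]
      ring_nf
    rw [hshift, mul_assoc, mem_rightQuotient_toList] at hd
    obtain ⟨i, hi, j, hj, h⟩ := hl (l + m) (Nat.le_add_right l m) (FreeMonoid.ofList d * u ^ r)
      u v y (fun H hH => huv H (.inr hH)) (by simpa only [mul_assoc] using hd)
    refine ⟨k + 1 + i, by omega, j, hj, ?_⟩
    have hglue : u ^ ((r + 1) * (k + 1 + i)) =
        u ^ ((r + 1) * k + 1) * (u ^ r * u ^ ((r + 1) * i)) := by
      rw [← pow_add, ← pow_add]
      ring_nf
    have hassoc : x * u ^ ((r + 1) * (k + 1 + i)) * v * u ^ ((r + 1) * j) * y =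
        (x * u ^ ((r + 1) * k + 1)) * (u ^ r * u ^ ((r + 1) * i) * v * u ^ ((r + 1) * j) * y) := by
      simp only [hglue, mul_assoc]
    rw [hassoc, FreeMonoid.toList_mul, append_mem_markedConcat]
    refine .inr (mem_markedConcat.2 ⟨c, hc, d, mem_rightQuotient_toList.2 ?_, hcd⟩)
    simpa only [mul_assoc] using h

theorem MemPol.admitsInsertion (hC : IsQuotientingClass C) (hreg : ∀ K ∈ C, K.IsRegular)
    (hn : 0 < n) (hK : MemPol C K) : AdmitsInsertion C n K := by
  induction hK with
  | base K hK => exact admitsInsertion_of_mem hC hK (hreg K hK) n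
  | marked K a L _ _ ihK ihL => exact ihK.markedConcat hn ihL a
  | union K L _ _ ihK ihL => exact ihK.sup ihL

theorem mul_mem_of_isCPair {M : Type*} [Monoid M] {α : FreeMonoid A →* M}
    (hC : IsRegularQuotientingLattice C) {U : Set M} (hU : MemPol C (preimage α U)) {s t : M}
    (hst : IsCPair C α s t) (hn : 0 < n) (hs : IsIdempotentElem (s ^ n)) (x y : FreeMonoid A)
    (h : α x * s ^ (n + 1) * α y ∈ U) : α x * (s ^ n * t * s ^ n) * α y ∈ U := by
  obtain ⟨S, hSC, hS, k, hk⟩ := hU.admitsInsertion hC.isQuotienting hC.isRegular hn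
  obtain ⟨u, v, rfl, rfl, huv⟩ := hst.exists_words hC.isLattice hSC hS
  have hpow {i : ℕ} (hi : 0 < i) : α u ^ (n * i) = α u ^ n := by
    rw [pow_mul, hs.pow_eq hi.ne']
  have hmem : (x * u ^ (n * (k + 1) + 1) * y).toList ∈ preimage α U := by
    rwa [toList_mem_preimage, map_mul, map_mul, map_pow, pow_succ, hpow k.succ_pos, ← pow_succ]
  obtain ⟨i, hi, j, hj, hij⟩ := hk (k + 1) k.le_succ x u v y huv hmem
  simpa only [toList_mem_preimage, map_mul, map_pow, hpow hi, hpow hj, mul_assoc] using hij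

end Insertion

section Covers

variable {A M : Type*} [Monoid M] [PartialOrder M] {C : Set (Language A)} {α : FreeMonoid A →* M}
  {X Y : Set (FreeMonoid A)}

theorem le_one_of_isCPair (h : ∀ e t, IsIdempotentElem e → IsCPair C α e t → e * t * e ≤ e) {t : M}
    (ht : IsCPair C α 1 t) : t ≤ 1 := by
  simpa only [one_mul, mul_one] using h 1 t .one ht

/-- Each part `X ∩ α⁻¹(s)` of `X` lies in a language of `Pol(C)` all of whose words have image at
most `s`. -/
def Covered (C : Set (Language A)) (α : FreeMonoid A →* M) (X : Set (FreeMonoid A)) : Prop :=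
  ∀ s, ∃ H, MemPol C H ∧ (∀ w ∈ X, α w = s → w.toList ∈ H) ∧
    ∀ w : FreeMonoid A, w.toList ∈ H → α w ≤ s

theorem Covered.of_forall_map_eq (hC : ⊥ ∈ C) {s : M} (hX : ∀ x ∈ X, α x = s) {H : Language A}
    (hH : MemPol C H) (hXH : ∀ x ∈ X, x.toList ∈ H)
    (hHs : ∀ w : FreeMonoid A, w.toList ∈ H → α w ≤ s) : Covered C α X := by
  intro t
  by_cases hst : s = t
  · exact ⟨H, hH, fun w hw _ => hXH w hw, hst ▸ hHs⟩
  · exact ⟨⊥, .base _ hC, fun w hw h => hst ((hX w hw).symm.trans h), fun _ hw => hw.elim⟩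

theorem Covered.mono (hXY : X ⊆ Y) (hY : Covered C α Y) : Covered C α X := fun s =>
  let ⟨H, hH, hYH, hHs⟩ := hY s
  ⟨H, hH, fun w hw => hYH w (hXY hw), hHs⟩

theorem Covered.union (hX : Covered C α X) (hY : Covered C α Y) : Covered C α (X ∪ Y) := fun s =>
  let ⟨H, hH, hXH, hHs⟩ := hX s
  let ⟨K, hK, hYK, hKs⟩ := hY s
  ⟨H ⊔ K, .union _ _ hH hK, fun w hw h => hw.imp (hXH w · h) (hYK w · h),
    fun w hw => hw.elim (hHs w) (hKs w)⟩

theorem covered_one [Finite M] (hC : IsLatticeClass C) (h : ∀ t, IsCPair C α 1 t → t ≤ 1) :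
    Covered C α {1} := by
  obtain ⟨K, hKC, hK, hpair⟩ := exists_mem_forall_isCPair hC α 1
  refine .of_forall_map_eq hC.empty_mem (s := 1) ?_ (.base K hKC) ?_ fun w hw => h _ (hpair w hw)
  · rintro _ rfl
    exact map_one α
  · rintro _ rfl
    exact hK (map_one α)

variable [MulLeftMono M] [MulRightMono M]

theorem Covered.mul [Finite A] [Finite M] (hC : ⊥ ∈ C) (hq : IsQuotientingClass C)
    (hX : Covered C α X) (hY : Covered C α Y) : Covered C α (X * Y) := by
  intro s
  choose f hf hXf hfs using hX
  choose g hg hYg hgs using hY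
  refine ⟨⨆ (t) (t') (_ : t * t' = s), f t * g t',
    .iSup hC fun t => .iSup hC fun t' => .iSup hC fun _ => (hf t).mul hC hq (hg t'), ?_, ?_⟩
  · rintro _ ⟨x, hx, y, hy, rfl⟩ hs
    simp only [Language.mem_iSup]
    exact ⟨α x, α y, (map_mul α x y).symm.trans hs,
      x.toList, hXf _ x hx rfl, y.toList, hYg _ y hy rfl, rfl⟩
  · intro w hw
    simp only [Language.mem_iSup] at hw
    obtain ⟨t, t', rfl, x, hx, y, hy, hxy⟩ := hw
    obtain rfl : FreeMonoid.ofList x * FreeMonoid.ofList y = w := hxy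
    rw [map_mul]
    exact mul_le_mul' (hfs t _ hx) (hgs t' _ hy)

theorem covered_of [Finite M] (hC : IsLatticeClass C) (h : ∀ t, IsCPair C α 1 t → t ≤ 1) (a : A) :
    Covered C α {.of a} := by
  obtain ⟨K, hKC, hK, hpair⟩ := exists_mem_forall_isCPair hC α 1
  have hnil : [] ∈ K := hK (map_one α)
  have hle {w : List A} (hw : w ∈ K) : α (.ofList w) ≤ 1 := h _ (hpair _ hw)
  refine .of_forall_map_eq hC.empty_mem (s := α (.of a)) ?_
    (.marked K a K (.base K hKC) (.base K hKC)) ?_ fun w hw => ?_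
  · rintro _ rfl
    rfl
  · rintro _ rfl
    exact mem_markedConcat.2 ⟨[], hnil, [], hnil, rfl⟩
  · obtain ⟨p, hp, q, hq, hpq⟩ := mem_markedConcat.1 hw
    obtain rfl : FreeMonoid.ofList p * .of a * FreeMonoid.ofList q = w := by
      rw [mul_assoc]
      exact hpq
    simpa only [map_mul, one_mul, mul_one] using mul_le_mul' (mul_le_mul' (hle hp) le_rfl) (hle hq)

theorem Covered.mul_preimage_mul [Finite A] [Finite M] (hC : IsLatticeClass C)
    (hq : IsQuotientingClass C) {e : M} (he : IsIdempotentElem e)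
    (h : ∀ t, IsCPair C α e t → e * t * e ≤ e) (hXe : ∀ x ∈ X, α x = e) (hX : Covered C α X) :
    Covered C α (X * (α ⁻¹' {e}) * X) := by
  obtain ⟨K, hKC, hK, hpair⟩ := exists_mem_forall_isCPair hC α e
  obtain ⟨H, hH, hXH, hHe⟩ := hX e
  refine .of_forall_map_eq hC.empty_mem (s := e) ?_
    ((hH.mul hC.empty_mem hq (.base K hKC)).mul hC.empty_mem hq hH) ?_ fun w hw => ?_
  · rintro _ ⟨_, ⟨x, hx, v, hv, rfl⟩, y, hy, rfl⟩
    rw [map_mul, map_mul, hXe x hx, hXe y hy, show α v = e from hv, he.eq, he.eq]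
  · rintro _ ⟨_, ⟨x, hx, v, hv, rfl⟩, y, hy, rfl⟩
    exact ⟨_, ⟨x.toList, hXH x hx (hXe x hx), v.toList, hK hv, rfl⟩, y.toList,
      hXH y hy (hXe y hy), rfl⟩
  · obtain ⟨_, ⟨x, hx, v, hv, rfl⟩, y, hy, hxvy⟩ := hw
    obtain rfl : FreeMonoid.ofList x * FreeMonoid.ofList v * FreeMonoid.ofList y = w := hxvy
    rw [map_mul, map_mul]
    exact (mul_le_mul' (mul_le_mul' (hHe _ hx) le_rfl) (hHe _ hy)).trans (h _ (hpair _ hv))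

theorem isFactorizationFamily_covered [Finite A] [Finite M] (hC : IsLatticeClass C)
    (hq : IsQuotientingClass C)
    (h : ∀ e t, IsIdempotentElem e → IsCPair C α e t → e * t * e ≤ e) :
    IsFactorizationFamily α (Covered C α) where
  mono := .mono
  one := covered_one hC fun _ => le_one_of_isCPair h
  union := .union
  mul := .mul hC.empty_mem hq
  closure_of_idempotent {X e} he hXe hX := by
    have hone : Covered C α {1} := covered_one hC fun _ => le_one_of_isCPair h
    exact .mono (closure_subset_of_map_eq_idempotent he hXe)
      (((hone.union hX).union (hX.mul hC.empty_mem hq hX)).union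
        (hX.mul_preimage_mul hC hq he (fun t => h e t he) hXe))

theorem covered_univ [Finite A] [Finite M] (hC : IsLatticeClass C) (hq : IsQuotientingClass C)
    (h : ∀ e t, IsIdempotentElem e → IsCPair C α e t → e * t * e ≤ e) :
    Covered C α Set.univ := by
  have hP := isFactorizationFamily_covered hC hq h
  have hletters (T : Set A) : Covered C α (FreeMonoid.of '' T) := by
    induction T, T.toFinite using Set.Finite.induction_on with
    | empty => exact hP.mono (by simp) hP.one
    | @insert a T _ _ ih =>
      rw [Set.image_insert_eq, Set.insert_eq]
      exact (covered_of hC (fun _ => le_one_of_isCPair h) a).union ih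
  have huniv := hP.closure (hletters Set.univ)
  rwa [Set.image_univ, FreeMonoid.closure_range_of] at huniv

theorem memPol_preimage_of_isLowerSet [Finite A] [Finite M] (hC : IsLatticeClass C)
    (hq : IsQuotientingClass C)
    (h : ∀ e t, IsIdempotentElem e → IsCPair C α e t → e * t * e ≤ e) {U : Set M}
    (hU : IsLowerSet U) : MemPol C (preimage α U) := by
  choose f hf hαf hfα using covered_univ hC hq h
  have hpre : preimage α U = ⨆ s ∈ U, f s := by
    ext w
    simp only [Language.mem_iSup]
    constructor
    · exact fun hw => ⟨_, hw, hαf _ (FreeMonoid.ofList w) trivial rfl⟩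
    · rintro ⟨s, hs, hw⟩
      exact hU (hfα s (FreeMonoid.ofList w) hw) hs
  rw [hpre]
  exact .iSup hC.empty_mem fun s => .iSup hC.empty_mem fun _ => hf s

end Covers

section SyntacticOrder

variable {A : Type*} {C : Set (Language A)} {L : Language A}

instance instMulLeftMonoSyntacticMonoid : MulLeftMono (SyntacticMonoid L) where
  elim r s t hst x y := by
    simpa only [mul_assoc] using hst (x * r) y

instance instMulRightMonoSyntacticMonoid : MulRightMono (SyntacticMonoid L) where
  elim r s t hst x y := by
    simpa only [Function.swap, mul_assoc] using hst x (r * y)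

theorem isUpperSet_acceptingSet (L : Language A) : IsUpperSet (acceptingSet L) := by
  intro s t hst hs
  simpa only [one_mul, mul_one] using hst 1 1 (by simpa only [one_mul, mul_one] using hs)

theorem pow_mul_mul_pow_le_of_mem_coPol (hC : IsRegularQuotientingLattice C) (hL : L ∈ coPol C)
    {s t : SyntacticMonoid L} (hst : IsCPair C (syntacticHom L) s t) {n : ℕ} (hn : 0 < n)
    (hs : IsIdempotentElem (s ^ n)) : s ^ n * t * s ^ n ≤ s ^ (n + 1) := by
  intro p q
  obtain ⟨x, rfl⟩ := syntacticHom_surjective L p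
  obtain ⟨y, rfl⟩ := syntacticHom_surjective L q
  refine not_imp_not.1 (mul_mem_of_isCPair (U := (acceptingSet L)ᶜ) hC ?_ hst hn hs x y)
  rwa [preimage_acceptingSet_compl]

theorem mem_coPol_of_forall_isCPair [Finite A] (hC : IsLatticeClass C) (hq : IsQuotientingClass C)
    (hL : L.IsRegular)
    (h : ∀ e t, IsIdempotentElem e → IsCPair C (syntacticHom L) e t → e * t * e ≤ e) :
    L ∈ coPol C := by
  have := finite_syntacticMonoid hL
  have hcompl := memPol_preimage_of_isLowerSet hC hq h (isUpperSet_acceptingSet L).compl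
  rwa [preimage_acceptingSet_compl] at hcompl

end SyntacticOrder

end PolynomialClosure

theorem mainTheorem5 {A : Type*} [Finite A] (C : Set (Language A))
    (hC : PolynomialClosure.IsRegularQuotientingLattice C)
    (L : Language A) (hL : L.IsRegular) :
    List.TFAE [
      L ∈ PolynomialClosure.coPol C,
      ∀ s t : PolynomialClosure.SyntacticMonoid L,
        PolynomialClosure.IsCPair C (PolynomialClosure.syntacticHom L) s t →
          s ^ PolynomialClosure.omegaPow (PolynomialClosure.SyntacticMonoid L) * t *
              s ^ PolynomialClosure.omegaPow (PolynomialClosure.SyntacticMonoid L) ≤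
            s ^ (PolynomialClosure.omegaPow (PolynomialClosure.SyntacticMonoid L) + 1),
      ∀ e t : PolynomialClosure.SyntacticMonoid L,
        IsIdempotentElem e →
          PolynomialClosure.IsCPair C (PolynomialClosure.syntacticHom L) e t →
            e * t * e ≤ e] := by
  have := PolynomialClosure.finite_syntacticMonoid hL
  obtain ⟨hω, hidem⟩ := PolynomialClosure.omegaPow_spec (PolynomialClosure.SyntacticMonoid L)
  tfae_have 1 → 2 := fun h s _ hst =>
    PolynomialClosure.pow_mul_mul_pow_le_of_mem_coPol hC h hst hω (hidem s)
  tfae_have 2 → 3 := fun h e t he het => by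
    simpa only [he.pow_eq hω.ne', he.pow_succ_eq] using h e t het
  tfae_have 3 → 1 := PolynomialClosure.mem_coPol_of_forall_isCPair hC.isLattice hC.isQuotienting hL
  tfae_finish
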